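/- Let $(D,\mu)$ be a probability space, let $V_m$ be an $m$-dimensional complex vector space of functions $D\to\mathbb C$, and let $n>m$ be an integer. Functions are not identified when they agree almost everywhere, and $m$ is the dimension of $V_m$ as a space of functions. Let $B(D)$ be the space of all bounded functions $f:D\to\mathbb C$, and for functions on $D$ let $\|f\|_\infty=\sup_{x\in D}|f(x)|$ (with value $\infty$ if $f$ is unbounded) and, for $2\le p<\infty$, $\|f\|_p=\big(\int_D|f|^p\,d\mu\big)^{1/p}$, where the integral is read as a lower integral if $f$ is not measurable. For $e\in\mathbb C^N$ let $\|e\|_\infty=\max_i|e_i|$. Let $L_2(D,\mu)$ be the space of ($\mu$-a.e. equal to a measurable and) square-integrable functions on $D$. For points $x_1,\dots,x_N\in D$ and data $y\in\mathbb C^N$, the plain least squares approximation is $$\tilde f=\operatorname*{argmin}_{g\in V_m}\sum_{i=1}^N|y_i-g(x_i)|^2 .$$ 1. Let $2\le p\le\infty$ and $V_m\subset L_2(D,\mu)\cap B(D)$. Then there are points $x_1,\dots,x_{2n}\in D$ such that for all $f\in B(D)$ and all $e\in\mathbb C^{2n}$ the plain least squares approximation $\tilde f$ with $N=2n$ and $y_i=f(x_i)+e_i$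 is uniquely defined and satisfies $$\|f-\tilde f\|_p\le\Big(1+\sqrt2\cdot\frac{m^{1/2-1/p}}{1-\sqrt{m/n}}\Big)\Big(\min_{g\in V_m}\|f-g\|_\infty+\|e\|_\infty\Big),$$ where $1/p=0$ for $p=\infty$; in particular the minimum is attained. 2. Let $p=2$ and $V_m\subset L_2(D,\mu)$ (boundedness is not needed). Then there are $n$ points $x_1,\dots,x_n\in D$ such that for all $f\in B(D)$ and all $e\in\mathbb C^n$ the plain least squares approximation $\tilde f$ with $N=n$ and $y_i=f(x_i)+e_i$ is uniquely defined and, the minimum being attained, $$\|f-\tilde f\|_2\le\Big(1+\frac{1}{1-\sqrt{m/n}}\Big)\Big(\min_{g\in V_m}\|f-g\|_\infty+\|e\|_\infty\Big).$$ 3. Let $p=\infty$ and $V_m\subset B(D)$ (measurability is not needed). Then there are $n$ points $x_1,\dots,x_n\in D$ such that for all $f\in B(D)$ and all $e\in\mathbb C^n$ the plain least squares approximation $\tilde f$ with $N=n$ and $y_i=f(x_i)+e_i$ is uniquely defined and, the minimum being attained, $$\|f-\tilde f\|_\infty\le\Big(1+\frac{\sqrt m}{1-\sqrt{m/n}}\Big)\Big(\min_{g\in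 V_m}\|f-g\|_\infty+\|e\|_\infty\Big).$$ -/

import Mathlib

open MeasureTheory
open scoped ENNReal

noncomputable section

/-- The supremum norm of a complex-valued function, with value `∞` for unbounded functions.
It is used for functions on `D` and for noise vectors indexed by `Fin N`. -/
def supNorm {ι : Type*} (f : ι → ℂ) : ℝ≥0∞ := ⨆ i, ‖f i‖ₑ

/-- `f` belongs to the space `B(D)` of bounded functions; no measurability is involved. -/
def BoundedFun {D : Type*} (f : D → ℂ) : Prop := ∃ C : ℝ, ∀ x, ‖f x‖ ≤ C

/-- The norm `‖f‖_p` of a function (not of an equivalence class): the `L_p(D, μ)`-norm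
for `p < ∞`, and the supremum norm over all of `D` for `p = ∞`. -/
def pNorm {D : Type*} [MeasurableSpace D] (μ : Measure D) (p : ℝ≥0∞) (f : D → ℂ) : ℝ≥0∞ :=
  open Classical in if p = ∞ then supNorm f else eLpNorm f p μ

/-- `g` is a plain (unweighted) least squares approximation from `V` to the data `y i` at the
points `x i`: it minimizes `∑ i, |y i - g (x i)|²` over `g ∈ V`. -/
def IsLeastSquares {D : Type*} (V : Submodule ℂ (D → ℂ)) {N : ℕ} (x : Fin N → D)
    (y : Fin N → ℂ) (g : D → ℂ) : Prop :=
  g ∈ V ∧ ∀ g' ∈ V, ∑ i, ‖y i - g (x i)‖ ^ 2 ≤ ∑ i, ‖y i - g' (x i)‖ ^ 2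

/-- Plain least squares on `V` at the points `x` is a recovery method with constant `C`
in the `p`-norm: for all bounded `f`, the minimum `d` of `‖f - g‖_∞` over `g ∈ V` exists and,
for every noise vector `e`, the least squares approximation `f'` to the
data `f (x i) + e i` is uniquely defined and satisfies `‖f - f'‖_p ≤ C * (d + ‖e‖_∞)`. -/
def LeastSquaresRecovery {D : Type*} [MeasurableSpace D] (μ : Measure D)
    (V : Submodule ℂ (D → ℂ)) (p : ℝ≥0∞) {N : ℕ} (x : Fin N → D) (C : ℝ) : Prop :=
  ∀ f : D → ℂ, BoundedFun f →
    ∃ d : ℝ≥0∞, IsLeast {t | ∃ g ∈ V, supNorm (f - g) = t} d ∧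
      ∀ e : Fin N → ℂ,
        (∃! f', IsLeastSquares V x (fun i => f (x i) + e i) f') ∧
        ∀ f', IsLeastSquares V x (fun i => f (x i) + e i) f' →
          pNorm μ p (f - f') ≤ ENNReal.ofReal C * (d + supNorm e)

end

/-! Let `g` be a best uniform approximation of `f`. The samples of `f' - g` are the orthogonal
projection of the samples of the noisy residual, so their ℓ²-norm is at most `√N (d + ‖e‖_∞)`. It
therefore suffices to find points with `‖g‖_p ≤ C N^(-1/2) ‖g‖_ℓ²` on `V`
(`leastSquaresRecovery_of_stability`).

Such points come from a one-sided, unweighted form of the Batson-Spielman-Srivastava barrier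
argument (`LowerBarrier.exists_points`): if every Hermitian form exceeds each number below its trace
at some sample vector, then some `n` sample vectors have frame operator at least `(√n - √m)²`. The
condition holds for L²-orthonormal coordinates because forms average to their trace. Without a
measure, it holds for coordinates normalized by a determinant-optimal design, which also keep the
Christoffel function below `m` and cost the factor `√m` in the uniform norm. For general `p` the two
point sets are joined and the two bounds interpolated. -/

theorem supNorm_le_iff {ι : Type*} {f : ι → ℂ} {t : ℝ≥0∞} : supNorm f ≤ t ↔ ∀ i, ‖f i‖ₑ ≤ t :=
  iSup_le_iff

theorem enorm_le_supNorm {ι : Type*} (f : ι → ℂ) (i : ι) : ‖f i‖ₑ ≤ supNorm f :=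
  le_iSup (fun i => ‖f i‖ₑ) i

theorem BoundedFun.supNorm_ne_top {D : Type*} {f : D → ℂ} (hf : BoundedFun f) : supNorm f ≠ ∞ := by
  obtain ⟨C, hC⟩ := hf
  refine ne_top_of_le_ne_top (ENNReal.ofReal_ne_top (r := C)) (supNorm_le_iff.mpr fun i => ?_)
  rw [← ofReal_norm]
  exact ENNReal.ofReal_le_ofReal (hC i)

/-! ### Best uniform approximation -/

/-- A bounded function has a best uniform approximation in a finite-dimensional space. -/
theorem exists_isLeast_supNorm {D : Type*} (V : Submodule ℂ (D → ℂ)) [FiniteDimensional ℂ V]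
    {f : D → ℂ} (hf : BoundedFun f) :
    ∃ d : ℝ≥0∞, d ≠ ∞ ∧ IsLeast {t | ∃ g ∈ V, supNorm (f - g) = t} d := by
  obtain ⟨C, hC⟩ := id hf
  -- `V` may contain unbounded functions, so compactness is taken for pointwise convergence: the
  -- product of balls is compact, `V` is closed, and the error is lower semicontinuous. The
  -- competitor `0` has error at most `C`, so nothing outside `K` does better.
  set K : Set (D → ℂ) := (V : Set (D → ℂ)) ∩ Set.univ.pi fun x => Metric.closedBall (f x) C with hK
  have hKc : IsCompact K := (isCompact_univ_pi fun x => isCompact_closedBall _ _).inter_left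
    V.closed_of_finiteDimensional
  have h0 : (0 : D → ℂ) ∈ K := by
    refine ⟨V.zero_mem, fun x _ => ?_⟩
    simpa [Metric.mem_closedBall] using hC x
  have hlsc : LowerSemicontinuous fun g : D → ℂ => supNorm (f - g) :=
    lowerSemicontinuous_iSup fun x => Continuous.lowerSemicontinuous (by
      simp only [Pi.sub_apply]
      fun_prop)
  obtain ⟨g, hg, hmin⟩ := (hlsc.lowerSemicontinuousOn K).exists_isMinOn ⟨0, h0⟩ hKc
  have hle : supNorm (f - g) ≤ ENNReal.ofReal C := by
    refine (hmin h0).trans (supNorm_le_iff.mpr fun x => ?_)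
    rw [← ofReal_norm]
    exact ENNReal.ofReal_le_ofReal (by simpa using hC x)
  refine ⟨supNorm (f - g), ne_top_of_le_ne_top ENNReal.ofReal_ne_top hle, ⟨g, hg.1, rfl⟩, ?_⟩
  rintro _ ⟨g', hg', rfl⟩
  by_cases h : g' ∈ K
  · exact hmin h
  · refine hle.trans ?_
    have : ∃ x, C < ‖f x - g' x‖ := by
      by_contra! hcon
      exact h ⟨hg', fun x _ => by
        rw [Metric.mem_closedBall, dist_comm, dist_eq_norm]; exact hcon x⟩
    obtain ⟨x, hx⟩ := this
    refine le_trans ?_ (enorm_le_supNorm (f - g') x)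
    rw [← ofReal_norm]
    exact ENNReal.ofReal_le_ofReal hx.le

/-! ### Least squares as orthogonal projection -/

/-- Evaluation at the sampling points, as a map into Euclidean space. -/
def evalPoints {D : Type*} (V : Submodule ℂ (D → ℂ)) {N : ℕ} (x : Fin N → D) :
    V →ₗ[ℂ] EuclideanSpace ℂ (Fin N) where
  toFun g := WithLp.toLp 2 fun i => g.1 (x i)
  map_add' _ _ := rfl
  map_smul' _ _ := rfl

theorem sum_norm_sub_eval {D : Type*} (V : Submodule ℂ (D → ℂ)) {N : ℕ} (x : Fin N → D)
    (y : Fin N → ℂ) (g : V) :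
    ∑ i, ‖y i - g.1 (x i)‖ ^ 2 = ‖WithLp.toLp 2 y - evalPoints V x g‖ ^ 2 := by
  rw [EuclideanSpace.norm_sq_eq]
  rfl

/-- Plain least squares on a set of points that determines `V` is uniquely defined, and its values
at the points are obtained by an orthogonal projection. -/
theorem isLeastSquares_iff {D : Type*} (V : Submodule ℂ (D → ℂ)) {N : ℕ} (x : Fin N → D)
    (y : Fin N → ℂ) (g : V) :
    IsLeastSquares V x y g ↔ evalPoints V x g =
      (LinearMap.range (evalPoints V x)).starProjection (WithLp.toLp 2 y) := by
  set U := LinearMap.range (evalPoints V x) with hU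
  set Y : EuclideanSpace ℂ (Fin N) := WithLp.toLp 2 y
  have hpyth : ∀ u ∈ U, ‖Y - u‖ ^ 2 =
      ‖Y - U.starProjection Y‖ ^ 2 + ‖U.starProjection Y - u‖ ^ 2 := by
    intro u hu
    have h := U.starProjection_inner_eq_zero Y (U.starProjection Y - u)
      (U.sub_mem (U.starProjection_apply_mem Y) hu)
    have h2 := norm_add_sq_eq_norm_sq_add_norm_sq_of_inner_eq_zero _ _ h
    rw [sub_add_sub_cancel] at h2
    simpa only [sq] using h2
  constructor
  · rintro ⟨-, h⟩
    obtain ⟨g', hg'⟩ : U.starProjection Y ∈ U := U.starProjection_apply_mem Y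
    have h1 := h g'.1 g'.2
    rw [sum_norm_sub_eval, sum_norm_sub_eval, hg', hpyth _ ⟨g, rfl⟩] at h1
    have h2 : ‖U.starProjection Y - evalPoints V x g‖ ^ 2 ≤ 0 := by
      change _ ≤ ‖Y - U.starProjection Y‖ ^ 2 at h1
      linarith
    have h3 : ‖U.starProjection Y - evalPoints V x g‖ = 0 := by
      have := norm_nonneg (U.starProjection Y - evalPoints V x g)
      nlinarith
    exact (sub_eq_zero.mp (norm_eq_zero.mp h3)).symm
  · intro h
    refine ⟨g.2, fun g' hg' => ?_⟩
    rw [sum_norm_sub_eval, sum_norm_sub_eval V x y ⟨g', hg'⟩, h, hpyth _ ⟨⟨g', hg'⟩, rfl⟩]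
    simp [Y]

theorem existsUnique_isLeastSquares {D : Type*} (V : Submodule ℂ (D → ℂ)) {N : ℕ} (x : Fin N → D)
    (hx : ∀ g ∈ V, (∀ i, g (x i) = 0) → g = 0) (y : Fin N → ℂ) :
    ∃! f', IsLeastSquares V x y f' := by
  set U := LinearMap.range (evalPoints V x)
  obtain ⟨g, hg⟩ : U.starProjection (WithLp.toLp 2 y) ∈ U := U.starProjection_apply_mem _
  refine ⟨g, (isLeastSquares_iff V x y g).mpr hg, fun g' hg' => ?_⟩
  have h := (isLeastSquares_iff V x y ⟨g', hg'.1⟩).mp hg'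
  have h2 : evalPoints V x (⟨g', hg'.1⟩ - g) = 0 := by rw [map_sub, h, hg, sub_self]
  have := hx _ (⟨g', hg'.1⟩ - g : V).2 fun i =>
    congrArg (fun v : EuclideanSpace ℂ (Fin N) => v i) h2
  exact sub_eq_zero.mp this

/-- The projection fixes the samples of `g`, so the samples of `f' - g` are the projection of the
residual `y - g`, and projections do not increase norms. -/
theorem sum_norm_sq_isLeastSquares_sub_le {D : Type*} (V : Submodule ℂ (D → ℂ)) {N : ℕ}
    (x : Fin N → D) (y : Fin N → ℂ) {f' g : D → ℂ} (hf' : IsLeastSquares V x y f') (hg : g ∈ V) :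
    ∑ i, ‖(f' - g) (x i)‖ ^ 2 ≤ ∑ i, ‖y i - g (x i)‖ ^ 2 := by
  have h := (isLeastSquares_iff V x y ⟨f', hf'.1⟩).mp hf'
  set U := LinearMap.range (evalPoints V x)
  have hP : evalPoints V x (⟨f', hf'.1⟩ - ⟨g, hg⟩) =
      U.starProjection (WithLp.toLp 2 y - evalPoints V x ⟨g, hg⟩) := by
    rw [map_sub, map_sub, h, U.starProjection_eq_self_iff.mpr (LinearMap.mem_range_self _ _)]
  rw [sum_norm_sub_eval V x y ⟨g, hg⟩]
  calc _ = ‖evalPoints V x (⟨f', hf'.1⟩ - ⟨g, hg⟩)‖ ^ 2 := by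
        rw [EuclideanSpace.norm_sq_eq]; rfl
    _ ≤ _ := by
        rw [hP]
        gcongr
        exact U.norm_starProjection_apply_le _

/-! ### From stability to recovery -/

/-- A bound for `‖f - f'‖_p` in which `f - g` need not be measurable. -/
theorem pNorm_sub_le {D : Type*} [MeasurableSpace D] (μ : Measure D) [IsProbabilityMeasure μ]
    {p : ℝ≥0∞} (hp : 1 ≤ p) {f g h : D → ℂ} (hm : p ≠ ∞ → AEStronglyMeasurable (g - h) μ) :
    pNorm μ p (f - h) ≤ supNorm (f - g) + pNorm μ p (g - h) := by
  have hsub : ∀ x, ‖(f - h) x‖ₑ ≤ supNorm (f - g) + ‖(g - h) x‖ₑ := fun x => by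
    have : (f - h) x = (f - g) x + (g - h) x := by simp
    rw [this]
    exact (enorm_add_le _ _).trans (add_le_add_left (enorm_le_supNorm _ x) _)
  unfold pNorm
  split_ifs with hpt
  · exact supNorm_le_iff.mpr fun x => (hsub x).trans (add_le_add_right (enorm_le_supNorm _ x) _)
  · have hp0 : p ≠ 0 := (zero_lt_one.trans_le hp).ne'
    calc eLpNorm (f - h) p μ
        -- Replacing `f - g` by the constant bounding it removes the only possibly non-measurable
        -- term before Minkowski's inequality is used.
        ≤ eLpNorm ((fun _ => supNorm (f - g)) + fun x => ‖(g - h) x‖ₑ) p μ :=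
          eLpNorm_mono_enorm fun x => by simpa using hsub x
      _ ≤ eLpNorm (fun _ : D => supNorm (f - g)) p μ + eLpNorm (fun x => ‖(g - h) x‖ₑ) p μ :=
          eLpNorm_add_le aestronglyMeasurable_const (hm hpt).enorm.aestronglyMeasurable hp
      _ = _ := by
          rw [eLpNorm_const _ hp0 (NeZero.ne μ), eLpNorm_enorm]
          simp

/-- Stability of the sampled `ℓ²`-norm on `V` yields the recovery guarantee. -/
theorem leastSquaresRecovery_of_stability {D : Type*} [MeasurableSpace D] (μ : Measure D)
    [IsProbabilityMeasure μ] (V : Submodule ℂ (D → ℂ)) [FiniteDimensional ℂ V] {p : ℝ≥0∞}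
    (hp : 1 ≤ p) (hm : p ≠ ∞ → ∀ g ∈ V, AEStronglyMeasurable g μ) {N : ℕ} {x : Fin N → D}
    (hx : ∀ g ∈ V, (∀ i, g (x i) = 0) → g = 0) {C : ℝ} (hC : 0 ≤ C)
    (hst : ∀ g ∈ V, pNorm μ p g ≤ ENNReal.ofReal (C * √(∑ i, ‖g (x i)‖ ^ 2) / √N)) :
    LeastSquaresRecovery μ V p x (1 + C) := by
  intro f hf
  obtain ⟨d, hd, hleast⟩ := exists_isLeast_supNorm V hf
  refine ⟨d, hleast, fun e => ⟨existsUnique_isLeastSquares V x hx _, fun f' hf' => ?_⟩⟩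
  obtain ⟨g, hg, hgd⟩ := hleast.1
  have he : supNorm e ≠ ∞ := by
    refine BoundedFun.supNorm_ne_top ⟨∑ i, ‖e i‖, fun i => ?_⟩
    exact Finset.single_le_sum (f := fun i => ‖e i‖) (fun i _ => norm_nonneg _) (Finset.mem_univ i)
  set t := (d + supNorm e).toReal with ht
  have htt : d + supNorm e = ENNReal.ofReal t := (ENNReal.ofReal_toReal (by simp [hd, he])).symm
  have hpt : ∀ i, ‖f (x i) + e i - g (x i)‖ ≤ t := fun i => by
    have : ‖f (x i) + e i - g (x i)‖ₑ ≤ d + supNorm e := by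
      have h : f (x i) + e i - g (x i) = (f - g) (x i) + e i := by simp; ring
      rw [h]
      exact (enorm_add_le _ _).trans
        (add_le_add (hgd ▸ enorm_le_supNorm _ _) (enorm_le_supNorm _ _))
    rw [htt, ← ofReal_norm] at this
    exact (ENNReal.ofReal_le_ofReal_iff ENNReal.toReal_nonneg).mp this
  have hsum : ∑ i, ‖(f' - g) (x i)‖ ^ 2 ≤ N * t ^ 2 := by
    refine (sum_norm_sq_isLeastSquares_sub_le V x _ hf' hg).trans ?_
    calc _ ≤ ∑ _i : Fin N, t ^ 2 := Finset.sum_le_sum fun i _ => by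
          gcongr
          exact hpt i
      _ = _ := by simp
  have ht0 : 0 ≤ t := ENNReal.toReal_nonneg
  have hgf : pNorm μ p (g - f') ≤ ENNReal.ofReal (C * t) := by
    refine (hst _ (V.sub_mem hg hf'.1)).trans (ENNReal.ofReal_le_ofReal ?_)
    have h1 : √(∑ i, ‖(g - f') (x i)‖ ^ 2) ≤ √N * t := by
      have : ∑ i, ‖(g - f') (x i)‖ ^ 2 = ∑ i, ‖(f' - g) (x i)‖ ^ 2 :=
        Finset.sum_congr rfl fun i _ => by simp [norm_sub_rev]
      rw [this]
      refine (Real.sqrt_le_sqrt hsum).trans ?_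
      rw [Real.sqrt_mul (by positivity), Real.sqrt_sq ht0]
    -- For `N = 0` the quotient is `0` by the convention on division.
    rcases (Real.sqrt_nonneg (N : ℝ)).eq_or_lt with h | h
    · rw [← h, div_zero]; positivity
    · rw [div_le_iff₀ h]
      calc _ ≤ C * (√N * t) := by gcongr
        _ = _ := by ring
  calc pNorm μ p (f - f')
      ≤ supNorm (f - g) + pNorm μ p (g - f') :=
        pNorm_sub_le μ hp fun h => hm h _ (V.sub_mem hg hf'.1)
    _ ≤ ENNReal.ofReal t + ENNReal.ofReal (C * t) := by
        gcongr
        rw [hgd, ← htt]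
        exact le_self_add
    _ = ENNReal.ofReal (1 + C) * (d + supNorm e) := by
        rw [htt, ← ENNReal.ofReal_add ht0 (by positivity), ← ENNReal.ofReal_mul (by positivity)]
        congr 1
        ring

/-! ### Unisolvent points and the trace condition -/

/-- A `k`-dimensional space of functions is determined by the values at some `k` points. -/
theorem exists_unisolvent_points {D : Type*} [Nonempty D] (k : ℕ) :
    ∀ (V : Submodule ℂ (D → ℂ)) [FiniteDimensional ℂ V], Module.finrank ℂ V ≤ k →
      ∃ x : Fin k → D, ∀ g ∈ V, (∀ i, g (x i) = 0) → g = 0 := by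
  induction k with
  | zero =>
    intro V _ hV
    have hb : V = ⊥ := Submodule.finrank_eq_zero.mp (Nat.le_zero.mp hV)
    exact ⟨Fin.elim0, fun g hg _ => by rw [hb] at hg; simpa using hg⟩
  | succ k ih =>
    intro V _ hV
    by_cases hb : V = ⊥
    · exact ⟨fun _ => Classical.arbitrary D, fun g hg _ => by rw [hb] at hg; simpa using hg⟩
    · obtain ⟨g, hg, hg0⟩ := (Submodule.ne_bot_iff V).mp hb
      obtain ⟨y, hy⟩ := Function.ne_iff.mp hg0
      set W := V ⊓ LinearMap.ker (LinearMap.proj y : (D → ℂ) →ₗ[ℂ] ℂ) with hW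
      have hlt : W < V := lt_of_le_of_ne inf_le_left fun h => hy (by
        have : g ∈ W := h ▸ hg
        exact this.2)
      have : FiniteDimensional ℂ W := Submodule.finiteDimensional_inf_left _ _
      obtain ⟨x, hx⟩ := ih W (by
        have := Submodule.finrank_lt_finrank_of_lt hlt
        omega)
      refine ⟨Fin.cons y x, fun g hg h => hx g ⟨hg, ?_⟩ fun i => ?_⟩
      · simpa using h 0
      · simpa using h i.succ

open scoped Matrix ComplexOrder in
/-- The sampling condition: every Hermitian form exceeds on `S` every number below its trace. -/
def TraceSampling {D ι : Type*} [Fintype ι] (S : Set D) (b : D → ι → ℂ) : Prop :=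
  ∀ X : Matrix ι ι ℂ, X.IsHermitian → ∀ c : ℝ, c < X.trace.re →
    ∃ x ∈ S, c < (star (b x) ⬝ᵥ (X *ᵥ b x)).re

/-! ### One-sided sparsification by a lower barrier -/

namespace LowerBarrier

open Matrix
open scoped ComplexOrder

variable {ι : Type*} [Fintype ι]

/-- The potential comparison behind the lower barrier shift. -/
theorem potential_shift [Nonempty ι] {d : ι → ℝ} {ε δ : ℝ} (hδ : 0 < δ) (hεδ : δ * (1 + ε) < 1)
    (hd : ∀ i, δ < d i) (hε : ∑ i, (d i)⁻¹ ≤ ε) :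
    (∑ i, (d i - δ)⁻¹ - ∑ i, (d i)⁻¹) * (1 + ∑ i, (d i - δ)⁻¹) < ∑ i, ((d i - δ)⁻¹) ^ 2 := by
  have hpos : ∀ i, 0 < d i - δ := fun i => sub_pos.mpr (hd i)
  have hd0 : ∀ i, 0 < d i := fun i => hδ.trans (hd i)
  -- The potential grows by `δT`, and the right side equals `T + δR`. Since `T² ≤ Rε` by
  -- Cauchy-Schwarz, the left side is at most `δT(1 + ε) + δ²T² < T + δ²Rε ≤ T + δR`.
  set T := ∑ i, (d i - δ)⁻¹ * (d i)⁻¹ with hT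
  set R := ∑ i, ((d i - δ)⁻¹) ^ 2 * (d i)⁻¹ with hR
  have hTpos : 0 < T := Finset.sum_pos
    (fun i _ => mul_pos (inv_pos.mpr (hpos i)) (inv_pos.mpr (hd0 i))) Finset.univ_nonempty
  have hRpos : 0 ≤ R := Finset.sum_nonneg fun i _ => by have := hpos i; have := hd0 i; positivity
  have hΔ : ∑ i, (d i - δ)⁻¹ - ∑ i, (d i)⁻¹ = δ * T := by
    rw [hT, ← Finset.sum_sub_distrib, Finset.mul_sum]
    refine Finset.sum_congr rfl fun i _ => ?_
    have := (hpos i).ne'; have := (hd0 i).ne'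
    field_simp
    ring
  have hsq : ∑ i, ((d i - δ)⁻¹) ^ 2 = T + δ * R := by
    rw [hT, hR, Finset.mul_sum, ← Finset.sum_add_distrib]
    refine Finset.sum_congr rfl fun i _ => ?_
    have := (hpos i).ne'; have := (hd0 i).ne'
    field_simp
    ring
  have hCS : T ^ 2 ≤ R * ∑ i, (d i)⁻¹ := by
    refine Finset.sum_sq_le_sum_mul_sum_of_sq_le_mul _ (fun i _ => ?_) (fun i _ => ?_) fun i _ => ?_
    · have := hpos i; have := hd0 i; positivity
    · have := hd0 i; positivity
    · exact (by ring : _ = _).le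
  have hΦ : ∑ i, (d i - δ)⁻¹ ≤ ε + δ * T := by linarith
  have hTε : T ^ 2 ≤ R * ε := hCS.trans (mul_le_mul_of_nonneg_left hε hRpos)
  rw [hΔ, hsq]
  have h1 : δ * T * (1 + ∑ i, (d i - δ)⁻¹) ≤ δ * T * (1 + (ε + δ * T)) := by gcongr
  have h2 : T * (δ * (1 + ε)) < T * 1 := by gcongr
  have h3 : δ ^ 2 * T ^ 2 ≤ δ ^ 2 * (R * ε) := by gcongr
  have h4 : δ * R * (δ * ε) ≤ δ * R * 1 := by
    gcongr
    nlinarith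
  nlinarith

theorem inv_le_of_sum_inv_le {d : ι → ℝ} (hd : ∀ i, 0 < d i) {ε : ℝ}
    (h : ∑ i, (d i)⁻¹ ≤ ε) (i : ι) : ε⁻¹ ≤ d i := by
  have h1 : (d i)⁻¹ ≤ ε := (Finset.single_le_sum (f := fun i => (d i)⁻¹)
    (fun j _ => (inv_pos.mpr (hd j)).le) (Finset.mem_univ i)).trans h
  exact inv_le_of_inv_le₀ (hd i) h1

theorem re_dotProduct_vecMulVec_mulVec (v c : ι → ℂ) :
    (star c ⬝ᵥ (vecMulVec v (star v) *ᵥ c)).re = ‖star v ⬝ᵥ c‖ ^ 2 := by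
  have h : star c ⬝ᵥ v = star (star v ⬝ᵥ c) := by
    rw [← star_dotProduct_star, star_star, dotProduct_comm]
  rw [vecMulVec_mulVec, op_smul_eq_smul, dotProduct_smul, h, smul_eq_mul]
  rw [Complex.star_def, Complex.mul_conj, Complex.ofReal_re, Complex.normSq_eq_norm_sq]

theorem re_star_dotProduct_self (c : ι → ℂ) : (star c ⬝ᵥ c).re = ∑ j, ‖c j‖ ^ 2 := by
  simp only [dotProduct, Pi.star_apply, Complex.re_sum, Complex.star_def]
  refine Finset.sum_congr rfl fun j _ => ?_
  rw [mul_comm, Complex.mul_conj, Complex.ofReal_re, Complex.normSq_eq_norm_sq]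

variable [DecidableEq ι]

/-- The Hermitian matrix with eigenvalues `f` in the orthonormal basis given by `U`. -/
def unitaryDiag (U : Matrix ι ι ℂ) (f : ι → ℝ) : Matrix ι ι ℂ :=
  U * diagonal (fun i => (f i : ℂ)) * Uᴴ

theorem unitaryDiag_mul {U : Matrix ι ι ℂ} (hU : Uᴴ * U = 1) (f g : ι → ℝ) :
    unitaryDiag U f * unitaryDiag U g = unitaryDiag U (fun i => f i * g i) := by
  unfold unitaryDiag
  calc _ = U * diagonal (fun i => (f i : ℂ)) * (Uᴴ * U) * diagonal (fun i => (g i : ℂ)) * Uᴴ := by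
        simp only [Matrix.mul_assoc]
    _ = _ := by
        rw [hU, Matrix.mul_one, Matrix.mul_assoc U, diagonal_mul_diagonal]
        simp

theorem trace_unitaryDiag {U : Matrix ι ι ℂ} (hU : Uᴴ * U = 1) (f : ι → ℝ) :
    (unitaryDiag U f).trace = ((∑ i, f i : ℝ) : ℂ) := by
  unfold unitaryDiag
  rw [trace_mul_comm, ← Matrix.mul_assoc, hU, Matrix.one_mul, trace_diagonal]
  simp

theorem unitaryDiag_sub (U : Matrix ι ι ℂ) (f g : ι → ℝ) :
    unitaryDiag U f - unitaryDiag U g = unitaryDiag U (fun i => f i - g i) := by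
  unfold unitaryDiag
  rw [← Matrix.sub_mul, ← Matrix.mul_sub, diagonal_sub]
  simp

theorem unitaryDiag_const {U : Matrix ι ι ℂ} (hU : U * Uᴴ = 1) (c : ℝ) :
    unitaryDiag U (fun _ => c) = (c : ℂ) • 1 := by
  unfold unitaryDiag
  rw [← smul_one_eq_diagonal, Matrix.mul_smul, Matrix.mul_one, Matrix.smul_mul, hU]

theorem posDef_unitaryDiag {U : Matrix ι ι ℂ} (hU : Uᴴ * U = 1) {f : ι → ℝ} (hf : ∀ i, 0 < f i) :
    (unitaryDiag U f).PosDef := by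
  have hU' : U * Uᴴ = 1 := mul_eq_one_comm.mp hU
  refine (PosDef.diagonal fun i => by exact_mod_cast hf i).mul_mul_conjTranspose_same ?_
  intro x y h
  simpa [hU', Matrix.vecMul_vecMul] using congrArg (· ᵥ* Uᴴ) h

theorem exists_unitaryDiag {M : Matrix ι ι ℂ} (hM : M.PosDef) :
    ∃ (U : Matrix ι ι ℂ) (d : ι → ℝ), Uᴴ * U = 1 ∧ (∀ i, 0 < d i) ∧ M = unitaryDiag U d := by
  refine ⟨hM.1.eigenvectorUnitary, hM.1.eigenvalues, ?_, hM.eigenvalues_pos, ?_⟩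
  · exact Unitary.coe_star_mul_self hM.1.eigenvectorUnitary
  · exact hM.1.spectral_theorem

theorem unitaryDiag_inv {U : Matrix ι ι ℂ} (hU : Uᴴ * U = 1) {f : ι → ℝ} (hf : ∀ i, 0 < f i) :
    (unitaryDiag U f)⁻¹ = unitaryDiag U (fun i => (f i)⁻¹) := by
  refine Matrix.inv_eq_right_inv ?_
  rw [unitaryDiag_mul hU]
  have h : (fun i => f i * (f i)⁻¹) = fun _ => 1 := by
    funext i; exact mul_inv_cancel₀ (hf i).ne'
  rw [h, unitaryDiag_const (mul_eq_one_comm.mp hU)]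
  simp

/-- The trace of the Sherman-Morrison formula. -/
theorem trace_inv_add_vecMulVec {N : Matrix ι ι ℂ} (hN : N.PosDef) (v : ι → ℂ) :
    ((N + vecMulVec v (star v))⁻¹).trace.re = N⁻¹.trace.re -
      (star v ⬝ᵥ ((N⁻¹ * N⁻¹) *ᵥ v)).re / (1 + (star v ⬝ᵥ (N⁻¹ *ᵥ v)).re) := by
  set P := N⁻¹ with hP
  have hPp : P.PosDef := hN.inv
  have hNP : N * P = 1 := Matrix.mul_nonsing_inv _ ((Matrix.isUnit_iff_isUnit_det _).mp hN.isUnit)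
  obtain ⟨hq0, hqim⟩ := Complex.nonneg_iff.mp (hPp.posSemidef.dotProduct_mulVec_nonneg v)
  set q := (star v ⬝ᵥ (P *ᵥ v)).re with hq
  have hqc : star v ⬝ᵥ (P *ᵥ v) = (q : ℂ) := Complex.ext (by simp [hq]) (by simp [← hqim])
  have hstar : star (P *ᵥ v) = star v ᵥ* P := by rw [star_mulVec, hPp.1.eq]
  have h1q : (1 + (q : ℂ)) ≠ 0 := by
    have : (0 : ℝ) < 1 + q := by linarith
    exact_mod_cast this.ne'
  have hinv : (N + vecMulVec v (star v))⁻¹ =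
      P - (1 + (q : ℂ))⁻¹ • vecMulVec (P *ᵥ v) (star v ᵥ* P) := by
    refine Matrix.inv_eq_right_inv ?_
    rw [Matrix.add_mul, Matrix.mul_sub, Matrix.mul_sub, hNP, Matrix.mul_smul, Matrix.mul_smul,
      mul_vecMulVec, mulVec_mulVec, hNP, one_mulVec, vecMulVec_mul, vecMulVec_mul_vecMulVec,
      hqc, vecMulVec_smul]
    have : vecMulVec v (star v ᵥ* P) - (1 + (q : ℂ))⁻¹ • (q : ℂ) • vecMulVec v (star v ᵥ* P)
        = (1 + (q : ℂ))⁻¹ • vecMulVec v (star v ᵥ* P) := by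
      rw [smul_smul]
      nth_rw 1 [← one_smul ℂ (vecMulVec v (star v ᵥ* P))]
      rw [← sub_smul]
      congr 1
      field_simp
      ring
    rw [this]
    abel
  rw [hinv, trace_sub, trace_smul, trace_vecMulVec, dotProduct_comm, ← dotProduct_mulVec,
    mulVec_mulVec, Complex.sub_re, smul_eq_mul]
  have : (1 + (q : ℂ))⁻¹ = (((1 + q)⁻¹ : ℝ) : ℂ) := by push_cast; rfl
  rw [this, Complex.re_ofReal_mul, div_eq_inv_mul]

/-- Raising the barrier by `δ` increases the potential by `Δ`; the rank-one update lowers it by the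
Sherman-Morrison quotient. The drop is at least `Δ` as soon as the form of `N⁻² - ΔN⁻¹` is at least
`Δ` at `b x`. By `potential_shift` the trace of this matrix exceeds `Δ`, so the sampling condition
yields such a point. -/
theorem barrier_step [Nonempty ι] {D : Type*} {S : Set D} {b : D → ι → ℂ}
    (H : TraceSampling S b) {M : Matrix ι ι ℂ} (hM : M.PosDef) {ε δ : ℝ} (hε : 0 < ε) (hδ : 0 < δ)
    (hεδ : δ * (1 + ε) < 1) (htr : M⁻¹.trace.re ≤ ε) :
    ∃ x ∈ S, (M - (δ : ℂ) • 1 + vecMulVec (b x) (star (b x))).PosDef ∧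
      ((M - (δ : ℂ) • 1 + vecMulVec (b x) (star (b x)))⁻¹).trace.re ≤ ε := by
  obtain ⟨U, d, hU, hd, rfl⟩ := exists_unitaryDiag hM
  rw [unitaryDiag_inv hU hd, trace_unitaryDiag hU, Complex.ofReal_re] at htr
  have hlt : ∀ i, δ < d i := fun i => by
    refine lt_of_lt_of_le ?_ (inv_le_of_sum_inv_le hd htr i)
    rw [lt_inv_comm₀ hδ hε, lt_inv_comm₀ hε hδ, ← one_div, lt_div_iff₀ hε]
    nlinarith
  rw [← unitaryDiag_const (mul_eq_one_comm.mp hU), unitaryDiag_sub]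
  have hpos : ∀ i, 0 < d i - δ := fun i => sub_pos.mpr (hlt i)
  set N := unitaryDiag U (fun i => d i - δ) with hN
  have hNp : N.PosDef := posDef_unitaryDiag hU hpos
  have hNi : N⁻¹ = unitaryDiag U (fun i => (d i - δ)⁻¹) := unitaryDiag_inv hU hpos
  set Δ : ℝ := ∑ i, (d i - δ)⁻¹ - ∑ i, (d i)⁻¹ with hΔ
  have key := potential_shift hδ hεδ hlt htr
  have hherm : (N⁻¹ * N⁻¹ - (Δ : ℂ) • N⁻¹).IsHermitian := by
    have h := hNp.inv.1
    refine IsHermitian.sub ?_ ?_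
    · rw [IsHermitian, conjTranspose_mul, h.eq]
    · rw [IsHermitian, conjTranspose_smul, h.eq]
      simp
  obtain ⟨x, hxS, hx⟩ := H _ hherm Δ (by
    rw [trace_sub, trace_smul, hNi, unitaryDiag_mul hU, trace_unitaryDiag hU, trace_unitaryDiag hU,
      Complex.sub_re, smul_eq_mul, Complex.re_ofReal_mul, Complex.ofReal_re, Complex.ofReal_re]
    simp only [← sq]
    linarith)
  refine ⟨x, hxS, hNp.add_posSemidef (posSemidef_vecMulVec_self_star _), ?_⟩
  rw [trace_inv_add_vecMulVec hNp]
  have hq0 := (Complex.nonneg_iff.mp (hNp.inv.posSemidef.dotProduct_mulVec_nonneg (b x))).1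
  rw [sub_mulVec, dotProduct_sub, smul_mulVec, dotProduct_smul, Complex.sub_re, smul_eq_mul,
    Complex.re_ofReal_mul] at hx
  have h1 : Δ ≤ (star (b x) ⬝ᵥ ((N⁻¹ * N⁻¹) *ᵥ b x)).re /
      (1 + (star (b x) ⬝ᵥ (N⁻¹ *ᵥ b x)).re) := by
    rw [le_div_iff₀ (by linarith)]
    linarith
  have h2 : N⁻¹.trace.re = ∑ i, (d i - δ)⁻¹ := by
    rw [hNi, trace_unitaryDiag hU, Complex.ofReal_re]
  rw [h2]
  linarith

/-- The barrier starts at `-m/ε`, with `m` the cardinality of `ι`, where the empty sum has potential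
exactly `ε`. -/
theorem barrier_iterate [Nonempty ι] {D : Type*} {S : Set D} {b : D → ι → ℂ}
    (H : TraceSampling S b) {ε δ : ℝ} (hε : 0 < ε) (hδ : 0 < δ) (hεδ : δ * (1 + ε) < 1) (n : ℕ) :
    ∃ x : Fin n → D, (∀ i, x i ∈ S) ∧
      ((∑ i, vecMulVec (b (x i)) (star (b (x i)))) -
        ((n * δ - Fintype.card ι / ε : ℝ) : ℂ) • (1 : Matrix ι ι ℂ)).PosDef ∧
      (((∑ i, vecMulVec (b (x i)) (star (b (x i)))) -
        ((n * δ - Fintype.card ι / ε : ℝ) : ℂ) • (1 : Matrix ι ι ℂ))⁻¹).trace.re ≤ ε := by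
  induction n with
  | zero =>
    have hc : (0 : ℝ) < Fintype.card ι := by exact_mod_cast Fintype.card_pos
    have h1 : (∑ i : Fin 0, vecMulVec (b ((Fin.elim0 : Fin 0 → D) i)) (star (b (Fin.elim0 i)))) -
        (((0 : ℕ) * δ - Fintype.card ι / ε : ℝ) : ℂ) • (1 : Matrix ι ι ℂ) =
        unitaryDiag 1 (fun _ => Fintype.card ι / ε) := by
      rw [unitaryDiag_const (by simp)]
      simp
    refine ⟨Fin.elim0, fun i => i.elim0, ?_⟩
    rw [h1, unitaryDiag_inv (by simp) (fun _ => by positivity), trace_unitaryDiag (by simp)]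
    refine ⟨posDef_unitaryDiag (by simp) (fun _ => by positivity), ?_⟩
    simp only [Complex.ofReal_re, Finset.sum_const, Finset.card_univ, nsmul_eq_mul]
    apply le_of_eq
    field_simp
  | succ n ih =>
    obtain ⟨x, hxS, hp, htr⟩ := ih
    obtain ⟨y, hyS, hp', htr'⟩ := barrier_step H hp hε hδ hεδ htr
    have h : (∑ i, vecMulVec (b ((Fin.cons y x : Fin (n + 1) → D) i))
          (star (b ((Fin.cons y x : Fin (n + 1) → D) i)))) -
        (((n + 1 : ℕ) * δ - Fintype.card ι / ε : ℝ) : ℂ) • (1 : Matrix ι ι ℂ) =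
        (∑ i, vecMulVec (b (x i)) (star (b (x i)))) -
        ((n * δ - Fintype.card ι / ε : ℝ) : ℂ) • (1 : Matrix ι ι ℂ) - (δ : ℂ) • 1 +
        vecMulVec (b y) (star (b y)) := by
      rw [Fin.sum_univ_succ]
      simp only [Fin.cons_zero, Fin.cons_succ]
      rw [sub_sub, ← add_smul]
      have : (((n + 1 : ℕ) * δ - Fintype.card ι / ε : ℝ) : ℂ) =
          ((n * δ - Fintype.card ι / ε : ℝ) : ℂ) + (δ : ℂ) := by push_cast; ring
      rw [this]
      abel
    refine ⟨Fin.cons y x, Fin.cases hyS hxS, ?_⟩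
    rw [h]
    exact ⟨hp', htr'⟩

theorem exists_points_nonempty [Nonempty ι] {D : Type*} {S : Set D} {b : D → ι → ℂ}
    (H : TraceSampling S b) (n : ℕ) (hn : Fintype.card ι < n) :
    ∃ x : Fin n → D, (∀ i, x i ∈ S) ∧ ∀ c : ι → ℂ,
      (√n - √(Fintype.card ι)) ^ 2 * ∑ j, ‖c j‖ ^ 2 ≤ ∑ i, ‖star (b (x i)) ⬝ᵥ c‖ ^ 2 := by
  have hm0 : (0 : ℝ) < Fintype.card ι := by exact_mod_cast Fintype.card_pos
  have hmn : (Fintype.card ι : ℝ) < n := by exact_mod_cast hn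
  set s := √(Fintype.card ι : ℝ) with hs
  set t := √(n : ℝ) with ht
  have hs0 : 0 < s := Real.sqrt_pos.mpr hm0
  have hst : s < t := Real.sqrt_lt_sqrt hm0.le hmn
  have hs2 : (Fintype.card ι : ℝ) = s ^ 2 := (Real.sq_sqrt hm0.le).symm
  have ht2 : (n : ℝ) = t ^ 2 := (Real.sq_sqrt (hm0.trans hmn).le).symm
  have ht0 : 0 < t := hs0.trans hst
  have hd0 : 0 < t - s := sub_pos.mpr hst
  -- This `ε` maximizes `n/(1 + ε) - m/ε`, with value `(t - s)²`.
  set ε := s / (t - s) with hε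
  have hε0 : 0 < ε := by positivity
  -- The step must stay strictly below `1/(1 + ε) = (t - s)/t`. The total loss over `n` steps is
  -- kept below `1/ε`, which is regained at the end: potential at most `ε` puts every eigenvalue at
  -- least `1/ε` above the barrier.
  obtain ⟨δ, hδ1, hδ2⟩ : ∃ δ, max 0 ((t - s) / t - (t - s) / (s * t ^ 2)) < δ ∧ δ < (t - s) / t :=
    exists_between (max_lt (by positivity) (by
      have : 0 < (t - s) / (s * t ^ 2) := by positivity
      linarith))
  obtain ⟨hδ0, hδ1⟩ := max_lt_iff.mp hδ1
  have hεδ : δ * (1 + ε) < 1 := by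
    have : 1 + ε = t / (t - s) := by rw [hε]; field_simp; ring
    rw [this]
    calc δ * (t / (t - s)) < (t - s) / t * (t / (t - s)) := by gcongr
      _ = 1 := by field_simp
  obtain ⟨x, hxS, hp, htr⟩ := barrier_iterate H hε0 hδ0 hεδ n
  refine ⟨x, hxS, fun c => ?_⟩
  obtain ⟨U, d, hU, hd, hMU⟩ := exists_unitaryDiag hp
  rw [hMU, unitaryDiag_inv hU hd, trace_unitaryDiag hU, Complex.ofReal_re] at htr
  have hge := inv_le_of_sum_inv_le hd htr
  have hps : (unitaryDiag U d - ((ε⁻¹ : ℝ) : ℂ) • 1).PosSemidef := by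
    rw [← unitaryDiag_const (mul_eq_one_comm.mp hU), unitaryDiag_sub]
    refine PosSemidef.mul_mul_conjTranspose_same (PosSemidef.diagonal fun i => ?_) U
    have : (0 : ℝ) ≤ d i - ε⁻¹ := sub_nonneg.mpr (hge i)
    change (0 : ℂ) ≤ ((d i - ε⁻¹ : ℝ) : ℂ)
    exact_mod_cast this
  rw [← hMU, sub_sub, ← add_smul] at hps
  have h := (Complex.nonneg_iff.mp (hps.dotProduct_mulVec_nonneg c)).1
  rw [sub_mulVec, smul_mulVec, one_mulVec, dotProduct_sub, dotProduct_smul, ← Complex.ofReal_add,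
    smul_eq_mul, Complex.sub_re, Complex.re_ofReal_mul, re_star_dotProduct_self, sum_mulVec,
    dotProduct_sum, Complex.re_sum] at h
  simp only [re_dotProduct_vecMulVec_mulVec] at h
  refine le_trans ?_ (sub_nonneg.mp h)
  gcongr
  rw [hs2, ht2]
  have e1 : t ^ 2 * ((t - s) / t - (t - s) / (s * t ^ 2)) - s ^ 2 / ε + ε⁻¹ = (t - s) ^ 2 := by
    rw [hε]; field_simp; ring
  have e2 : t ^ 2 * ((t - s) / t - (t - s) / (s * t ^ 2)) ≤ t ^ 2 * δ := by gcongr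
  linarith

/-- Unweighted one-sided sparsification: `n` sampling points whose frame operator is bounded below
by `(√n - √m)²`, where `m` is the dimension. -/
theorem exists_points {D : Type*} {S : Set D} {b : D → ι → ℂ}
    (H : TraceSampling S b) (n : ℕ) (hn : Fintype.card ι < n) :
    ∃ x : Fin n → D, (∀ i, x i ∈ S) ∧ ∀ c : ι → ℂ,
      (√n - √(Fintype.card ι)) ^ 2 * ∑ j, ‖c j‖ ^ 2 ≤ ∑ i, ‖star (b (x i)) ⬝ᵥ c‖ ^ 2 := by
  cases isEmpty_or_nonempty ι
  -- Even in dimension zero the condition supplies a point of `S`, as `-1` lies below the empty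
  -- trace.
  · obtain ⟨x, hx, -⟩ := H 0 isHermitian_zero (-1) (by simp)
    exact ⟨fun _ => x, fun _ => hx, fun c => by simp⟩
  · exact exists_points_nonempty H n hn

end LowerBarrier

/-! ### Determinant-optimal designs -/

namespace OptimalDesign

open Matrix LowerBarrier
open scoped ComplexOrder

/-- Compare slopes as `s → 0+`; this extracts the first-order optimality condition of a determinant
maximizer. -/
theorem le_of_one_add_mul_le_pow {a : ℝ} {m : ℕ}
    (h : ∀ s : ℝ, 0 < s → 1 + s * a ≤ (1 + s) ^ m) : a ≤ m := by
  have hd : HasDerivAt (fun s : ℝ => (1 + s) ^ m) m 0 := by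
    have := ((hasDerivAt_id (0 : ℝ)).const_add 1).fun_pow m
    simpa using this
  have ht := (hasDerivAt_iff_tendsto_slope.mp hd).mono_left (nhdsGT_le_nhdsNE (0 : ℝ))
  refine ge_of_tendsto ht ?_
  filter_upwards [self_mem_nhdsWithin] with s hs
  have hs' : 0 < s := hs
  rw [slope_def_field, le_div_iff₀ (by simpa using hs')]
  have := h s hs'
  simp
  linarith

variable {ι : Type*}

theorem isClosed_posSemidef [Fintype ι] : IsClosed {A : Matrix ι ι ℂ | A.PosSemidef} := by
  have h : {A : Matrix ι ι ℂ | A.PosSemidef} =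
      {A | Aᴴ = A} ∩ ⋂ c : ι → ℂ, {A | 0 ≤ star c ⬝ᵥ (A *ᵥ c)} := by
    ext A
    simp only [Set.mem_ofPred_eq, Set.mem_inter_iff, Set.mem_iInter]
    exact posSemidef_iff_dotProduct_mulVec
  rw [h]
  refine (isClosed_eq (by fun_prop) (by fun_prop)).inter (isClosed_iInter fun c => ?_)
  have : {A : Matrix ι ι ℂ | 0 ≤ star c ⬝ᵥ (A *ᵥ c)} =
      (fun A : Matrix ι ι ℂ => star c ⬝ᵥ (A *ᵥ c)) ⁻¹' Set.Ici 0 := rfl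
  rw [this]
  exact isClosed_Ici.preimage (by fun_prop)

theorem convex_posSemidef : Convex ℝ {A : Matrix ι ι ℂ | A.PosSemidef} := by
  intro A hA B hB a b ha hb _
  exact (PosSemidef.smul hA ha).add (PosSemidef.smul hB hb)

/-- The closed convex hull of the rank-one matrices of a family of vectors. -/
def designHull {D : Type*} (v : D → ι → ℂ) : Set (Matrix ι ι ℂ) :=
  closure (convexHull ℝ (Set.range fun x => vecMulVec (v x) (star (v x))))

theorem convex_designHull {D : Type*} (v : D → ι → ℂ) : Convex ℝ (designHull v) :=
  (convex_convexHull ℝ _).closure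

theorem mem_designHull {D : Type*} (v : D → ι → ℂ) (x : D) :
    vecMulVec (v x) (star (v x)) ∈ designHull v :=
  subset_closure (subset_convexHull ℝ _ ⟨x, rfl⟩)

theorem designHull_subset {D : Type*} {v : D → ι → ℂ} {P : Set (Matrix ι ι ℂ)} (hP : Convex ℝ P)
    (hPc : IsClosed P) (h : ∀ x, vecMulVec (v x) (star (v x)) ∈ P) : designHull v ⊆ P :=
  closure_minimal (convexHull_min (Set.range_subset_iff.mpr h) hP) hPc

theorem isCompact_designHull [Finite ι] {D : Type*} {v : D → ι → ℂ} {C : ℝ} (hC : ∀ x j, ‖v x j‖ ≤ C) :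
    IsCompact (designHull v) := by
  have hcpt : IsCompact (Set.univ.pi fun _ : ι => Set.univ.pi fun _ : ι =>
      Metric.closedBall (0 : ℂ) (C * C)) :=
    isCompact_univ_pi fun _ => isCompact_univ_pi fun _ => isCompact_closedBall _ _
  refine hcpt.of_isClosed_subset isClosed_closure (designHull_subset ?_ hcpt.isClosed fun x => ?_)
  · exact convex_pi fun _ _ => convex_pi fun _ _ => convex_closedBall _ _
  · intro i _ j _
    rw [mem_closedBall_zero_iff, vecMulVec_apply, norm_mul, Pi.star_apply, norm_star]
    exact mul_le_mul (hC x i) (hC x j) (norm_nonneg _) ((norm_nonneg _).trans (hC x i))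

variable [Fintype ι] [DecidableEq ι]

/-- The matrix determinant lemma; real parts factor because the determinant of `M` is real. -/
theorem det_add_smul_vecMulVec {M : Matrix ι ι ℂ} (hM : M.PosDef) (v : ι → ℂ) (s : ℝ) :
    (M + (s : ℂ) • vecMulVec v (star v)).det.re =
      M.det.re * (1 + s * (star v ⬝ᵥ (M⁻¹ *ᵥ v)).re) := by
  have hu : IsUnit M.det := (Matrix.isUnit_iff_isUnit_det _).mp hM.isUnit
  have him : M.det.im = 0 := (Complex.pos_iff.mp hM.det_pos).2.symm
  have h := det_add_replicateCol_mul_replicateRow (ι := Unit) hu ((s : ℂ) • v) (star v)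
  rw [← vecMulVec_eq, smul_vecMulVec] at h
  rw [h, det_unique (n := Unit), Matrix.add_apply, Matrix.one_apply_eq, Matrix.mul_assoc, Complex.mul_re, him,
    zero_mul, sub_zero]
  congr 1
  have : (replicateRow Unit (star v) * (M⁻¹ * replicateCol Unit ((s : ℂ) • v))) default default =
      (s : ℂ) * (star v ⬝ᵥ (M⁻¹ *ᵥ v)) := by
    rw [← smul_eq_mul, ← dotProduct_smul, ← mulVec_smul]
    rfl
  rw [this, Complex.add_re, Complex.re_ofReal_mul, Complex.one_re]

/-- A determinant maximizer on the design hull has leverage at most the dimension. -/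
theorem leverage_le {D : Type*} {v : D → ι → ℂ} {M : Matrix ι ι ℂ} (hM : M.PosDef)
    (hMK : M ∈ designHull v) (hmax : ∀ A ∈ designHull v, A.det.re ≤ M.det.re) (x : D) :
    (star (v x) ⬝ᵥ (M⁻¹ *ᵥ v x)).re ≤ Fintype.card ι := by
  refine le_of_one_add_mul_le_pow fun s hs => ?_
  have h1s : 0 < 1 + s := by linarith
  have hmem := convex_designHull v hMK (mem_designHull v x) (a := (1 + s)⁻¹) (b := (1 + s)⁻¹ * s)
    (by positivity) (by positivity) (by field_simp)
  -- Pulling out `(1 + s)⁻¹` turns maximality, by homogeneity of the determinant, into `1 + s *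
  -- leverage ≤ (1 + s) ^ m`.
  have heq : (1 + s)⁻¹ • M + ((1 + s)⁻¹ * s) • vecMulVec (v x) (star (v x)) =
      (((1 + s)⁻¹ : ℝ) : ℂ) • (M + (s : ℂ) • vecMulVec (v x) (star (v x))) := by
    rw [smul_add, smul_smul, ← Complex.ofReal_mul, Complex.coe_smul, Complex.coe_smul]
  rw [heq] at hmem
  have h := hmax _ hmem
  rw [det_smul, ← Complex.ofReal_pow, Complex.re_ofReal_mul, det_add_smul_vecMulVec hM] at h
  have hd : 0 < M.det.re := (Complex.pos_iff.mp hM.det_pos).1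
  have hpow : 0 < (1 + s) ^ Fintype.card ι := by positivity
  rw [inv_pow, inv_mul_le_iff₀ hpow] at h
  nlinarith

/-- The continuous real-linear functional `A ↦ Re tr(BXBA)` gives the form of `X` at `B v(x)` on
rank-one matrices and `Re tr X` at `M`. An upper bound at all points would pass to the closed convex
hull, hence to `M`. -/
theorem traceSampling_of_mem_designHull {D : Type*} {v : D → ι → ℂ} {M B : Matrix ι ι ℂ}
    (hMK : M ∈ designHull v) (hB : B.IsHermitian) (hBM : B * M * B = 1) :
    TraceSampling Set.univ fun x => B *ᵥ v x := by
  intro X _ c hc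
  by_contra! hcon
  set L : Matrix ι ι ℂ →ₗ[ℝ] ℝ :=
    { toFun := fun A => ((B * X * B) * A).trace.re
      map_add' := fun A A' => by rw [Matrix.mul_add, trace_add, Complex.add_re]
      map_smul' := fun r A => by
        rw [Matrix.mul_smul, trace_smul, Complex.smul_re]; rfl } with hL
  have hLv : ∀ x, L (vecMulVec (v x) (star (v x))) =
      (star (B *ᵥ v x) ⬝ᵥ (X *ᵥ (B *ᵥ v x))).re := fun x => by
    change ((B * X * B) * vecMulVec (v x) (star (v x))).trace.re = _
    rw [mul_vecMulVec, trace_vecMulVec, dotProduct_comm, star_mulVec, hB.eq, ← dotProduct_mulVec,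
      mulVec_mulVec, mulVec_mulVec, Matrix.mul_assoc]
  have hLc : Continuous L := by
    change Continuous fun A : Matrix ι ι ℂ => ((B * X * B) * A).trace.re
    fun_prop
  have hsub : designHull v ⊆ {A | L A ≤ c} := by
    refine designHull_subset ?_ (isClosed_le hLc continuous_const) fun x => ?_
    · exact convex_halfSpace_le L.isLinear c
    · exact (hLv x).trans_le (hcon x (Set.mem_univ x))
  have h1 : L M ≤ c := hsub hMK
  have h2 : L M = X.trace.re := by
    change ((B * X * B) * M).trace.re = _
    rw [Matrix.mul_assoc, trace_mul_comm, ← Matrix.mul_assoc, trace_mul_comm, hBM, Matrix.mul_one]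
  linarith

/-- A form of the Kiefer-Wolfowitz theorem: a space of bounded functions has coordinates with
Christoffel function at most the dimension in which the trace sampling condition holds. -/
theorem exists_coordinates {D : Type*} [Nonempty D] (V : Submodule ℂ (D → ℂ))
    [FiniteDimensional ℂ V] (hb : ∀ g ∈ V, BoundedFun g) :
    ∃ w : D → Fin (Module.finrank ℂ V) → ℂ, TraceSampling Set.univ w ∧
      (∀ x, ∑ j, ‖w x j‖ ^ 2 ≤ Module.finrank ℂ V) ∧
      ∀ g ∈ V, ∃ c, ∀ x, g x = star (w x) ⬝ᵥ c := by
  set m := Module.finrank ℂ V with hm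
  let b := Module.finBasis ℂ V
  set v : D → Fin m → ℂ := fun x j => star ((b j).1 x) with hv
  have hrep : ∀ g : V, ∀ x, g.1 x = star (v x) ⬝ᵥ ⇑(b.repr g) := fun g x => by
    conv_lhs => rw [← b.sum_repr g]
    simp only [Submodule.coe_sum, Finset.sum_apply, dotProduct, Submodule.coe_smul, Pi.smul_apply,
      smul_eq_mul, hv, Pi.star_apply, star_star]
    exact Finset.sum_congr rfl fun j _ => mul_comm _ _
  choose C hC using fun j => hb (b j).1 (b j).2
  have hvC : ∀ x j, ‖v x j‖ ≤ ∑ j, |C j| := fun x j => by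
    refine le_trans ?_ (Finset.single_le_sum (f := fun j => |C j|) (fun j _ => abs_nonneg _)
      (Finset.mem_univ j))
    simpa [hv] using (hC j x).trans (le_abs_self _)
  have hcont : Continuous fun A : Matrix (Fin m) (Fin m) ℂ => A.det.re := by fun_prop
  -- A positive definite average in the hull forces the maximal determinant to be positive. Using `m
  -- + 1` points keeps the average nonempty when `m = 0`.
  obtain ⟨y, hy⟩ := exists_unisolvent_points (m + 1) V (Nat.le_succ _)
  have hsumpd : (∑ i, vecMulVec (v (y i)) (star (v (y i)))).PosDef := by
    refine PosDef.of_dotProduct_mulVec_pos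
      (posSemidef_sum _ fun i _ => posSemidef_vecMulVec_self_star _).1 fun c hc => ?_
    have hps : (∑ i, vecMulVec (v (y i)) (star (v (y i)))).PosSemidef :=
      posSemidef_sum _ fun i _ => posSemidef_vecMulVec_self_star _
    have h0 := hps.dotProduct_mulVec_nonneg c
    refine lt_of_le_of_ne h0 fun h => hc ?_
    have h' := congrArg Complex.re h
    rw [sum_mulVec, dotProduct_sum, Complex.re_sum] at h'
    simp only [re_dotProduct_vecMulVec_mulVec, Complex.zero_re] at h'
    have hz := (Finset.sum_eq_zero_iff_of_nonneg fun i _ => sq_nonneg _).mp h'.symm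
    have hg := hy (b.equivFun.symm c : V).1 (b.equivFun.symm c).2 fun i => by
      rw [hrep, ← b.equivFun_apply, LinearEquiv.apply_symm_apply]
      simpa using hz i (Finset.mem_univ i)
    have hg' : b.equivFun.symm c = 0 := Subtype.ext hg
    exact b.equivFun.symm.map_eq_zero_iff.mp hg'
  have hM0 : ((m + 1 : ℝ)⁻¹ • ∑ i, vecMulVec (v (y i)) (star (v (y i)))) ∈ designHull v := by
    rw [Finset.smul_sum]
    refine (convex_designHull v).sum_mem (fun i _ => by positivity) ?_ fun i _ => mem_designHull v _
    simp
    field_simp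
  obtain ⟨M, hMK, hmax⟩ := (isCompact_designHull hvC).exists_isMaxOn ⟨_, hM0⟩ hcont.continuousOn
  have hMps : M.PosSemidef := designHull_subset convex_posSemidef isClosed_posSemidef
    (fun x => posSemidef_vecMulVec_self_star _) hMK
  have hMpd : M.PosDef := by
    rw [hMps.posDef_iff_det_ne_zero]
    intro h0
    have h1 := hmax hM0
    have h2 := (Complex.pos_iff.mp
      (PosDef.smul hsumpd (by positivity : (0 : ℝ) < (m + 1 : ℝ)⁻¹)).det_pos).1
    simp only [Set.mem_ofPred_eq, h0, Complex.zero_re] at h1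
    exact absurd h2 (not_lt.mpr h1)
  obtain ⟨U, d, hU, hd, hMU⟩ := exists_unitaryDiag hMpd
  have hsq : ∀ i, 0 < √(d i) := fun i => Real.sqrt_pos.mpr (hd i)
  -- `B` and `E` are `M^(-1/2)` and `M^(1/2)`; the squared length of `B v(x)` is the leverage at
  -- `x`.
  set B := unitaryDiag U (fun i => (√(d i))⁻¹) with hBdef
  set E := unitaryDiag U (fun i => √(d i)) with hEdef
  have hB : B.IsHermitian := (posDef_unitaryDiag hU fun i => inv_pos.mpr (hsq i)).1
  have hone : unitaryDiag U (fun _ => 1) = 1 := by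
    rw [unitaryDiag_const (mul_eq_one_comm.mp hU)]; simp
  have hBE : B * E = 1 := by
    rw [hBdef, hEdef, unitaryDiag_mul hU, ← hone]
    congr 1; funext i; exact inv_mul_cancel₀ (hsq i).ne'
  have hBB : B * B = M⁻¹ := by
    rw [hMU, unitaryDiag_inv hU hd, hBdef, unitaryDiag_mul hU]
    congr 1; funext i
    rw [← mul_inv, Real.mul_self_sqrt (hd i).le]
  have hBMB : B * M * B = 1 := by
    have hEE : M = E * E := by
      rw [hMU, hEdef, unitaryDiag_mul hU]
      congr 1; funext i; exact (Real.mul_self_sqrt (hd i).le).symm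
    rw [hEE, ← Matrix.mul_assoc, hBE, Matrix.one_mul, mul_eq_one_comm.mp hBE]
  refine ⟨fun x => B *ᵥ v x, traceSampling_of_mem_designHull hMK hB hBMB, fun x => ?_, fun g hg => ?_⟩
  · have h := leverage_le hMpd hMK (fun A hA => hmax hA) x
    rw [Fintype.card_fin, ← hBB, ← mulVec_mulVec, dotProduct_mulVec] at h
    nth_rw 1 [← hB.eq] at h
    rw [← star_mulVec, re_star_dotProduct_self] at h
    exact h
  · refine ⟨E *ᵥ ⇑(b.repr ⟨g, hg⟩), fun x => ?_⟩
    rw [star_mulVec, hB.eq, ← dotProduct_mulVec, mulVec_mulVec, hBE, one_mulVec]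
    exact hrep ⟨g, hg⟩ x

end OptimalDesign

/-! ### Stability in the uniform norm -/

/-- On a space of bounded functions of dimension `m`, the uniform norm is controlled by the values
at some `n > m` points. -/
theorem exists_points_supNorm_le {D : Type*} [Nonempty D] (V : Submodule ℂ (D → ℂ))
    [FiniteDimensional ℂ V] (hb : ∀ g ∈ V, BoundedFun g) (n : ℕ) (hn : Module.finrank ℂ V < n) :
    ∃ x : Fin n → D, ∀ g ∈ V, supNorm g ≤ ENNReal.ofReal
      (√(Module.finrank ℂ V) * (√(∑ i, ‖g (x i)‖ ^ 2) / (√n - √(Module.finrank ℂ V)))) := by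
  set m := Module.finrank ℂ V
  obtain ⟨w, hw, hwm, hrep⟩ := OptimalDesign.exists_coordinates V hb
  obtain ⟨x, -, hx⟩ := LowerBarrier.exists_points hw n (by simpa using hn)
  refine ⟨x, fun g hg => supNorm_le_iff.mpr fun y => ?_⟩
  obtain ⟨c, hc⟩ := hrep g hg
  have hpos : 0 < √(n : ℝ) - √(m : ℝ) :=
    sub_pos.mpr (Real.sqrt_lt_sqrt (by positivity) (by exact_mod_cast hn))
  rw [← ofReal_norm]
  refine ENNReal.ofReal_le_ofReal ?_
  have h1 : ‖g y‖ ≤ √m * √(∑ j, ‖c j‖ ^ 2) := by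
    rw [hc, dotProduct]
    calc _ ≤ ∑ j, ‖w y j‖ * ‖c j‖ := (norm_sum_le _ _).trans_eq
          (Finset.sum_congr rfl fun j _ => by simp)
      _ ≤ √(∑ j, ‖w y j‖ ^ 2) * √(∑ j, ‖c j‖ ^ 2) := Real.sum_mul_le_sqrt_mul_sqrt _ _ _
      _ ≤ _ := by gcongr; exact hwm y
  refine h1.trans ?_
  gcongr
  rw [le_div_iff₀ hpos]
  refine Real.le_sqrt_of_sq_le ?_
  rw [mul_pow, Real.sq_sqrt (by positivity), mul_comm]
  have h := hx c
  rw [Fintype.card_fin] at h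
  simpa only [← hc] using h

/-! ### Stability in L² -/

section SquareIntegrable

variable {D : Type*} [MeasurableSpace D] (μ : Measure D)

/-- The map sending a square-integrable function to its class in `L²`. -/
noncomputable def toL2 (V : Submodule ℂ (D → ℂ)) (h2 : ∀ g ∈ V, MemLp g 2 μ) : V →ₗ[ℂ] Lp ℂ 2 μ where
  toFun g := (h2 g.1 g.2).toLp g.1
  map_add' g g' := MemLp.toLp_add (h2 g.1 g.2) (h2 g'.1 g'.2)
  map_smul' c g := MemLp.toLp_const_smul c (h2 g.1 g.2)

variable {μ} {V : Submodule ℂ (D → ℂ)} (h2 : ∀ g ∈ V, MemLp g 2 μ)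

theorem inner_toL2 (g g' : V) :
    inner ℂ (toL2 μ V h2 g) (toL2 μ V h2 g') = ∫ x, g'.1 x * star (g.1 x) ∂μ := by
  rw [L2.inner_def]
  refine integral_congr_ae ?_
  filter_upwards [(h2 g.1 g.2).coeFn_toLp, (h2 g'.1 g'.2).coeFn_toLp] with x hx hx'
  change inner ℂ ((h2 g.1 g.2).toLp g.1 x) ((h2 g'.1 g'.2).toLp g'.1 x) = _
  rw [hx, hx']
  rfl

open Matrix in
/-- Orthonormal functions satisfy the trace sampling condition on every set of full measure. -/
theorem traceSampling_of_orthonormal [IsProbabilityMeasure μ] {ι : Type*} [Fintype ι] (u : ι → V)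
    (hu : Orthonormal ℂ fun j => toL2 μ V h2 (u j)) {S : Set D} (hS : ∀ᵐ x ∂μ, x ∈ S) :
    TraceSampling S fun x j => star ((u j).1 x) := by
  classical
  intro X _ c hc
  by_contra! hcon
  have hexp : ∀ x, star (fun j => star ((u j).1 x)) ⬝ᵥ (X *ᵥ fun j => star ((u j).1 x)) =
      ∑ i, ∑ j, X i j * ((u i).1 x * star ((u j).1 x)) := fun x => by
    simp only [dotProduct, mulVec, Pi.star_apply, star_star, Finset.mul_sum]
    refine Finset.sum_congr rfl fun i _ => Finset.sum_congr rfl fun j _ => ?_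
    ring
  have hint : ∀ i j, Integrable (fun x => X i j * ((u i).1 x * star ((u j).1 x))) μ := fun i j =>
    ((h2 _ (u i).2).integrable_mul (h2 _ (u j).2).star).const_mul _
  have hint' : Integrable (fun x => ∑ i, ∑ j, X i j * ((u i).1 x * star ((u j).1 x))) μ :=
    integrable_finsetSum _ fun i _ => integrable_finsetSum _ fun j _ => hint i j
  -- Orthonormality makes the mean of the form equal to the trace, so it cannot be at most `c`
  -- almost everywhere.
  have hval : ∫ x, ∑ i, ∑ j, X i j * ((u i).1 x * star ((u j).1 x)) ∂μ = X.trace := by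
    rw [integral_finsetSum _ fun i _ => integrable_finsetSum _ fun j _ => hint i j]
    refine Finset.sum_congr rfl fun i _ => ?_
    rw [integral_finsetSum _ fun j _ => hint i j]
    simp_rw [integral_const_mul, ← inner_toL2 h2, orthonormal_iff_ite.mp hu]
    simp
  have hle : ∫ x, (∑ i, ∑ j, X i j * ((u i).1 x * star ((u j).1 x))).re ∂μ ≤ ∫ _x : D, c ∂μ := by
    refine integral_mono_ae hint'.re (integrable_const c) ?_
    filter_upwards [hS] with x hx
    change (∑ i, ∑ j, X i j * ((u i).1 x * star ((u j).1 x))).re ≤ c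
    rw [← hexp]
    exact hcon x hx
  have hre : ∫ x, (∑ i, ∑ j, X i j * ((u i).1 x * star ((u j).1 x))).re ∂μ = X.trace.re := by
    rw [← hval]
    exact integral_re hint'
  rw [hre] at hle
  simp at hle
  linarith

/-- Concavity of the square root: spending `k` points on a `k`-dimensional subspace does not worsen
the constant. -/
theorem sqrt_sub_sqrt_le_sqrt_sub_sqrt {a b k : ℝ} (ha : 0 ≤ a) (hk : 0 ≤ k) (hab : a ≤ b) :
    √(b + k) - √(a + k) ≤ √b - √a := by
  have h1 := Real.sq_sqrt ha
  have h2 := Real.sq_sqrt (ha.trans hab)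
  have h3 := Real.sq_sqrt (add_nonneg ha hk)
  have h4 := Real.sq_sqrt (add_nonneg (ha.trans hab) hk)
  have h5 : √a ≤ √(a + k) := Real.sqrt_le_sqrt (by linarith)
  have h6 : √b ≤ √(b + k) := Real.sqrt_le_sqrt (by linarith)
  have h7 : √a ≤ √b := Real.sqrt_le_sqrt hab
  have h8 : 0 ≤ √a := Real.sqrt_nonneg a
  by_contra! h
  nlinarith

/-- On an `m`-dimensional space of square-integrable functions, the `L²`-norm is controlled by the
values at some `n > m` points, which moreover determine the functions everywhere. -/
theorem exists_points_eLpNorm_le [IsProbabilityMeasure μ] [FiniteDimensional ℂ V]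
    (h2 : ∀ g ∈ V, MemLp g 2 μ) (n : ℕ) (hn : Module.finrank ℂ V < n) :
    ∃ x : Fin n → D, (∀ g ∈ V, (∀ i, g (x i) = 0) → g = 0) ∧ ∀ g ∈ V, eLpNorm g 2 μ ≤
      ENNReal.ofReal (√(∑ i, ‖g (x i)‖ ^ 2) / (√n - √(Module.finrank ℂ V))) := by
  have : Nonempty D := μ.nonempty_of_neZero
  set T := toL2 μ V h2 with hT
  set K := LinearMap.ker T with hK
  set R := LinearMap.range T with hR
  have hdim : Module.finrank ℂ R + Module.finrank ℂ K = Module.finrank ℂ V :=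
    T.finrank_range_add_finrank_ker
  set r := Module.finrank ℂ R with hr
  set k := Module.finrank ℂ K with hk
  let o := stdOrthonormalBasis ℂ R
  choose u hu using fun j => (o j).2
  have horth : Orthonormal ℂ fun j => T (u j) := by
    have := o.orthonormal.comp_linearIsometry R.subtypeₗᵢ
    convert! this using 1
    funext j
    exact hu j
  have : Module.Free ℂ K := Module.Free.of_divisionRing ℂ K
  let bK := Module.finBasis ℂ K
  -- `K` holds the functions of `V` that vanish almost everywhere, which L² cannot see. On `S` all
  -- of them vanish, so expansions modulo `K` hold pointwise there.
  set S : Set D := {x | ∀ j, (bK j).1.1 x = 0} with hS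
  have hSae : ∀ᵐ x ∂μ, x ∈ S := by
    refine ae_all_iff.mpr fun j => ?_
    have h0 : (h2 _ (bK j).1.2).toLp (bK j).1.1 = 0 := (bK j).2
    filter_upwards [(h2 _ (bK j).1.2).coeFn_toLp, Lp.coeFn_zero ℂ 2 μ] with x hx hx'
    rw [← hx, h0, hx']
    rfl
  have hSK : ∀ x ∈ S, ∀ g : K, g.1.1 x = 0 := fun x hx g => by
    rw [← bK.sum_repr g]
    simp only [Submodule.coe_sum, Submodule.coe_smul, Finset.sum_apply, Pi.smul_apply]
    exact Finset.sum_eq_zero fun j _ => by rw [hx j, smul_zero]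
  -- The remaining `k` points are reserved for determining `K`.
  obtain ⟨n', rfl⟩ : ∃ n', n = n' + k := ⟨n - k, by omega⟩
  obtain ⟨x, hxS, hx⟩ := LowerBarrier.exists_points
    (traceSampling_of_orthonormal h2 u horth hSae) n' (by rw [Fintype.card_fin]; omega)
  rw [Fintype.card_fin] at hx
  have hstab : ∀ g : V, (√n' - √r) * ‖T g‖ ≤ √(∑ i, ‖g.1 (x i)‖ ^ 2) := fun g => by
    set c : Fin r → ℂ := fun j => o.repr ⟨T g, g, rfl⟩ j with hc
    have hsum : ∑ j, c j • T (u j) = T g := by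
      have h := congrArg (Subtype.val) (o.sum_repr ⟨T g, g, rfl⟩)
      simp only [Submodule.coe_sum, Submodule.coe_smul] at h
      simpa only [hu] using h
    have hnorm : ‖T g‖ ^ 2 = ∑ j, ‖c j‖ ^ 2 := by
      have h := (o.repr.norm_map ⟨T g, g, rfl⟩)
      rw [Submodule.coe_norm] at h
      rw [← h, EuclideanSpace.norm_sq_eq]
    have hker : g - ∑ j, c j • u j ∈ K := by
      rw [hK, LinearMap.mem_ker, map_sub, map_sum, sub_eq_zero, ← hsum]
      simp
    have hval : ∀ y ∈ S, g.1 y = star (fun j => star ((u j).1 y)) ⬝ᵥ c := fun y hy => by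
      have h := hSK y hy ⟨_, hker⟩
      simp only [Submodule.coe_sub, Submodule.coe_sum, Submodule.coe_smul, Pi.sub_apply,
        Finset.sum_apply, Pi.smul_apply, smul_eq_mul] at h
      rw [sub_eq_zero.mp h]
      simp only [dotProduct, Pi.star_apply, star_star]
      exact Finset.sum_congr rfl fun j _ => mul_comm _ _
    refine Real.le_sqrt_of_sq_le ?_
    rw [mul_pow, hnorm]
    refine (hx c).trans_eq (Finset.sum_congr rfl fun i _ => ?_)
    rw [hval _ (hxS i)]
  have hlt : (r : ℝ) < n' := by exact_mod_cast (by omega : r < n')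
  have hpos' : 0 < √(n' : ℝ) - √(r : ℝ) :=
    sub_pos.mpr (Real.sqrt_lt_sqrt (Nat.cast_nonneg _) hlt)
  obtain ⟨y, hy⟩ := exists_unisolvent_points k (K.map V.subtype)
    (Submodule.finrank_map_le _ _)
  refine ⟨Fin.append x y, fun g hg h0 => ?_, fun g hg => ?_⟩
  · have hx0 : ∀ i, g (x i) = 0 := fun i => by simpa using h0 (Fin.castAdd k i)
    have hy0 : ∀ i, g (y i) = 0 := fun i => by simpa using h0 (Fin.natAdd n' i)
    refine hy g ⟨⟨g, hg⟩, ?_, rfl⟩ hy0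
    have h := hstab ⟨g, hg⟩
    simp only [hx0, norm_zero] at h
    have : ‖T ⟨g, hg⟩‖ ≤ 0 := by
      by_contra! hcon
      have := mul_pos hpos' hcon
      simp at h
      linarith
    exact norm_le_zero_iff.mp this
  · have hposn : 0 < √((n' + k : ℕ) : ℝ) - √(Module.finrank ℂ V : ℝ) :=
      sub_pos.mpr (Real.sqrt_lt_sqrt (Nat.cast_nonneg _) (by exact_mod_cast hn))
    have hsub : √((n' + k : ℕ) : ℝ) - √(Module.finrank ℂ V : ℝ) ≤ √(n' : ℝ) - √(r : ℝ) := by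
      rw [← hdim]
      push_cast
      exact sqrt_sub_sqrt_le_sqrt_sub_sqrt (Nat.cast_nonneg _) (Nat.cast_nonneg _) hlt.le
    have hT2 : eLpNorm g 2 μ = ENNReal.ofReal ‖T ⟨g, hg⟩‖ := by
      rw [← ENNReal.ofReal_toReal (h2 g hg).2.ne]
      congr 1
      exact (Lp.norm_toLp g (h2 g hg)).symm
    rw [hT2]
    refine ENNReal.ofReal_le_ofReal ?_
    rw [le_div_iff₀ hposn, mul_comm]
    calc _ ≤ (√(n' : ℝ) - √(r : ℝ)) * ‖T ⟨g, hg⟩‖ := by gcongr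
      _ ≤ √(∑ i, ‖g (x i)‖ ^ 2) := hstab ⟨g, hg⟩
      _ ≤ _ := by
        refine Real.sqrt_le_sqrt ?_
        rw [Fin.sum_univ_add]
        simp only [Fin.append_left, Fin.append_right]
        exact le_add_of_nonneg_right (Finset.sum_nonneg fun i _ => sq_nonneg _)

end SquareIntegrable

/-! ### Interpolation and conclusion -/

/-- Integrate `|g|^p ≤ ‖g‖_∞^(p-2) |g|²`. -/
theorem eLpNorm_le_of_supNorm_le {D : Type*} [MeasurableSpace D] (μ : Measure D) {p : ℝ≥0∞}
    (hp : 2 ≤ p) (hpt : p ≠ ∞) {g : D → ℂ} {m a : ℝ} (hm : 0 ≤ m) (ha : 0 ≤ a)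
    (h2 : eLpNorm g 2 μ ≤ ENNReal.ofReal a) (hs : supNorm g ≤ ENNReal.ofReal (√m * a)) :
    eLpNorm g p μ ≤ ENNReal.ofReal (m ^ ((1 : ℝ) / 2 - 1 / p.toReal) * a) := by
  have hq : 2 ≤ p.toReal := by
    simpa using (ENNReal.toReal_le_toReal (by simp) hpt).mpr hp
  have hp0 : p ≠ 0 := (lt_of_lt_of_le (by simp) hp).ne'
  set q := p.toReal with hqdef
  have hq0 : 0 < q := by linarith
  have hint : ∫⁻ x, ‖g x‖ₑ ^ (2 : ℝ) ∂μ ≤ ENNReal.ofReal (a ^ (2 : ℝ)) := by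
    rw [eLpNorm_eq_lintegral_rpow_enorm_toReal (by simp) (by simp)] at h2
    simp only [ENNReal.toReal_ofNat, one_div] at h2
    rw [ENNReal.rpow_inv_le_iff (by norm_num)] at h2
    rwa [← ENNReal.ofReal_rpow_of_nonneg ha (by norm_num)]
  rw [eLpNorm_eq_lintegral_rpow_enorm_toReal hp0 hpt, one_div, ← hqdef,
    ENNReal.rpow_inv_le_iff hq0]
  have hsq : ∀ x, ‖g x‖ₑ ^ q ≤ ENNReal.ofReal ((√m * a) ^ (q - 2)) * ‖g x‖ₑ ^ (2 : ℝ) := fun x => by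
    have : q = (q - 2) + 2 := by ring
    nth_rw 1 [this]
    rw [ENNReal.rpow_add_of_nonneg _ _ (by linarith) (by norm_num),
      ← ENNReal.ofReal_rpow_of_nonneg (by positivity) (by linarith)]
    gcongr
    exact (enorm_le_supNorm g x).trans hs
  calc _ ≤ ∫⁻ x, ENNReal.ofReal ((√m * a) ^ (q - 2)) * ‖g x‖ₑ ^ (2 : ℝ) ∂μ := lintegral_mono hsq
    _ = ENNReal.ofReal ((√m * a) ^ (q - 2)) * ∫⁻ x, ‖g x‖ₑ ^ (2 : ℝ) ∂μ :=
        lintegral_const_mul' _ _ ENNReal.ofReal_ne_top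
    _ ≤ ENNReal.ofReal ((√m * a) ^ (q - 2)) * ENNReal.ofReal (a ^ (2 : ℝ)) := by gcongr
    _ = _ := by
      rw [← ENNReal.ofReal_mul (by positivity), ENNReal.ofReal_rpow_of_nonneg (by positivity) hq0.le]
      congr 1
      rw [Real.mul_rpow (by positivity) ha, Real.mul_rpow (by positivity) ha, mul_assoc,
        ← Real.rpow_add_of_nonneg ha (by linarith) (by norm_num), sub_add_cancel,
        Real.sqrt_eq_rpow, ← Real.rpow_mul hm, ← Real.rpow_mul hm]
      congr 2
      field_simp

theorem pNorm_le_of_stability {D : Type*} [MeasurableSpace D] (μ : Measure D) {p : ℝ≥0∞}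
    (hp : 2 ≤ p) {g : D → ℂ} {m a : ℝ} (hm : 0 ≤ m) (ha : 0 ≤ a)
    (h2 : eLpNorm g 2 μ ≤ ENNReal.ofReal a) (hs : supNorm g ≤ ENNReal.ofReal (√m * a)) :
    pNorm μ p g ≤ ENNReal.ofReal (m ^ ((1 : ℝ) / 2 - 1 / p.toReal) * a) := by
  unfold pNorm
  split_ifs with hpt
  -- Here `p.toReal = 0` and `1 / 0 = 0`, so the exponent is `1/2`.
  · simpa [hpt, Real.sqrt_eq_rpow] using hs
  · exact eLpNorm_le_of_supNorm_le μ hp hpt hm ha h2 hs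

theorem div_one_sub_sqrt_div {m n : ℝ} (hn : 0 < n) (c s : ℝ) :
    c / (1 - √(m / n)) * s / √n = c * (s / (√n - √m)) := by
  have h0 : √n ≠ 0 := (Real.sqrt_pos.mpr hn).ne'
  have : 1 - √(m / n) = (√n - √m) / √n := by
    rw [Real.sqrt_div' _ hn.le]
    field_simp
  rw [this, div_div_eq_mul_div, div_mul_eq_mul_div, div_right_comm, mul_right_comm,
    mul_div_cancel_right₀ _ h0, mul_div_assoc]

theorem corollary3p4 {D : Type*} [MeasurableSpace D] (μ : Measure D) [IsProbabilityMeasure μ]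
    (V : Submodule ℂ (D → ℂ)) [FiniteDimensional ℂ V] (m n : ℕ)
    (hm : Module.finrank ℂ V = m) (hn : m < n) :
    (∀ p : ℝ≥0∞, 2 ≤ p → (∀ g ∈ V, MemLp g 2 μ) → (∀ g ∈ V, BoundedFun g) →
      ∃ x : Fin (2 * n) → D, LeastSquaresRecovery μ V p x
        (1 + √2 * ((m : ℝ) ^ ((1 : ℝ) / 2 - 1 / p.toReal) / (1 - √((m : ℝ) / (n : ℝ)))))) ∧
    ((∀ g ∈ V, MemLp g 2 μ) →
      ∃ x : Fin n → D, LeastSquaresRecovery μ V 2 x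
        (1 + 1 / (1 - √((m : ℝ) / (n : ℝ))))) ∧
    ((∀ g ∈ V, BoundedFun g) →
      ∃ x : Fin n → D, LeastSquaresRecovery μ V ∞ x
        (1 + √(m : ℝ) / (1 - √((m : ℝ) / (n : ℝ))))) := by
  have : Nonempty D := μ.nonempty_of_neZero
  have hn0 : (0 : ℝ) < n := by exact_mod_cast (Nat.zero_le m).trans_lt hn
  have hmn : (m : ℝ) < n := by exact_mod_cast hn
  have hd : 0 < √(n : ℝ) - √(m : ℝ) := sub_pos.mpr (Real.sqrt_lt_sqrt (Nat.cast_nonneg _) hmn)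
  have hθ : 0 < 1 - √((m : ℝ) / n) := by
    rw [sub_pos, Real.sqrt_lt' one_pos, one_pow, div_lt_one hn0]
    exact hmn
  have hn' : Module.finrank ℂ V < n := hm ▸ hn
  refine ⟨fun p hp h2 hb => ?_, fun h2 => ?_, fun hb => ?_⟩
  · obtain ⟨x, hx0, hx⟩ := exists_points_eLpNorm_le h2 n hn'
    obtain ⟨y, hy⟩ := exists_points_supNorm_le V hb n hn'
    rw [hm] at hx hy
    rw [two_mul]
    have hsumx : ∀ g : D → ℂ, ∑ i, ‖g (x i)‖ ^ 2 ≤ ∑ i, ‖g (Fin.append x y i)‖ ^ 2 := fun g => by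
      rw [Fin.sum_univ_add]
      simp only [Fin.append_left, Fin.append_right]
      exact le_add_of_nonneg_right (Finset.sum_nonneg fun i _ => sq_nonneg _)
    have hsumy : ∀ g : D → ℂ, ∑ i, ‖g (y i)‖ ^ 2 ≤ ∑ i, ‖g (Fin.append x y i)‖ ^ 2 := fun g => by
      rw [Fin.sum_univ_add]
      simp only [Fin.append_left, Fin.append_right]
      exact le_add_of_nonneg_left (Finset.sum_nonneg fun i _ => sq_nonneg _)
    -- Joining the point sets only enlarges the sampled sum, so both bounds survive; `√2` comes from
    -- normalizing by `√(2n)` instead of `√n`.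
    refine ⟨Fin.append x y, leastSquaresRecovery_of_stability μ V (le_trans (by simp) hp)
      (fun _ g hg => (h2 g hg).1) (fun g hg h => hx0 g hg fun i => ?_) (by positivity)
      fun g hg => ?_⟩
    · simpa using h (Fin.castAdd n i)
    · refine (pNorm_le_of_stability μ hp (Nat.cast_nonneg m)
        (a := √(∑ i, ‖g (Fin.append x y i)‖ ^ 2) / (√n - √m)) (by positivity)
        ((hx g hg).trans ?_) ((hy g hg).trans ?_)).trans_eq ?_
      · refine ENNReal.ofReal_le_ofReal ?_
        gcongr ?_ / _
        exact Real.sqrt_le_sqrt (hsumx g)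
      · refine ENNReal.ofReal_le_ofReal ?_
        gcongr _ * (?_ / _)
        exact Real.sqrt_le_sqrt (hsumy g)
      · rw [← div_one_sub_sqrt_div hn0]
        congr 1
        have : √((n + n : ℕ) : ℝ) = √2 * √n := by
          rw [← Real.sqrt_mul (by norm_num)]
          congr 1
          push_cast
          ring
        rw [this, mul_assoc, mul_div_mul_left _ _ (by positivity)]
  · obtain ⟨x, hx0, hx⟩ := exists_points_eLpNorm_le h2 n hn'
    rw [hm] at hx
    refine ⟨x, leastSquaresRecovery_of_stability μ V (by simp) (fun _ g hg => (h2 g hg).1) hx0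
      (by positivity) fun g hg => ?_⟩
    rw [div_one_sub_sqrt_div hn0, one_mul]
    simpa [pNorm] using hx g hg
  · obtain ⟨x, hx⟩ := exists_points_supNorm_le V hb n hn'
    rw [hm] at hx
    refine ⟨x, leastSquaresRecovery_of_stability μ V (by simp) (fun h => absurd rfl h)
      (fun g hg h => ?_) (by positivity) fun g hg => ?_⟩
    · have h0 := hx g hg
      simp only [h, norm_zero] at h0
      funext y
      have := (enorm_le_supNorm g y).trans h0
      simpa using this
    · rw [div_one_sub_sqrt_div hn0]
      simpa [pNorm] using hx g hg
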